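/- Let $X$ be a compact smooth manifold with a Riemannian distance $d$, $\mu$ a Borel probability measure on $X$, and $T:X\to X$ a measurable map preserving $\mu$. For $\eta>0$ and $\varphi:X\to\mathbb R$ put $[\varphi]_\eta=\sup_{x\ne y}|\varphi(x)-\varphi(y)|/d(x,y)^\eta$; $\varphi$ is $\eta$-Hölder if $[\varphi]_\eta<\infty$, and Hölder if this holds for some $\eta>0$. Assume that $(X,T,\mu)$ has the following multiple decorrelation property: for every $\eta\in(0,1]$ there exist $C>0$ and $\delta\in(0,1)$ such that for all integers $m,m'\ge 0$, all $\eta$-Hölder functions $\varphi_1,\dots,\varphi_{m+m'}:X\to\mathbb R$ and all integers $0\le \ell_1\le\dots\le\ell_m\le k_1\le\dots\le k_{m'}$ and $N>0$, $$\mathrm{Cov}_\mu\Big(\prod_{i=1}^m\varphi_i\circ T^{\ell_i},\ \prod_{j=1}^{m'}\varphi_{m+j}\circ T^{k_j+N}\Big)\le C\Big(\prod_{i=1}^{m+m'}\|\varphi_i\|_\infty+\sum_{j=1}^{m+m'}[\varphi_j]_\eta\prod_{i\ne j}\|\varphi_i\|_\infty\Big)\delta^N .$$ Let $(\theta_x)_{x\in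 X}$ be a family of maps $X\to X$ that are Hölder continuous with an exponent and a constant independent of $x$ (that is, $d(\theta_x(z),\theta_x(w))\le A\,d(z,w)^{\eta'}$ for all $x,z,w$, for some $A$ and some $\eta'>0$), and such that for some $\eta>0$ and some $C$ $$\sup_{z\in X}d(\theta_x(z),\theta_y(z))\le C\,d(x,y)^\eta\qquad (x,y\in X).$$ Let $\varphi:X\to\mathbb R$ be a Hölder function with $\int_X\varphi\,d\mu=0$, and put $$\varphi_{\theta_x}:=\varphi\circ\theta_x-\int_X\varphi\circ\theta_x\,d\mu,\qquad \sigma^2_{\theta_x}:=\int_X\varphi_{\theta_x}^2\,d\mu+2\sum_{k=1}^\infty\int_X\varphi_{\theta_x}\cdot(\varphi_{\theta_x}\circ T^k)\,d\mu .$$ Then the series defining $\sigma^2_{\theta_x}$ converges absolutely for every $x\in X$, all the integrals below are those of $\mu$-integrable functions, and $$\int_X\frac1n\Big(\sum_{k=1}^n\varphi_{\theta_x}(T^kx)\Big)^2d\mu(x)\ \longrightarrow\ \int_X\sigma^2_{\theta_x}\,d\mu(x)\qquad(n\to\infty).$$ -/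

import Mathlib

open scoped NNReal Manifold ContDiff Bundle Topology
open MeasureTheory

noncomputable section

/-- The uniform norm of a (bounded) real function on `X`. -/
def supNorm {X : Type*} (f : X → ℝ) : ℝ := ⨆ x, |f x|

/-- Multiple decorrelation for `T` and `μ`, for Hölder functions of order `η`: there are constants
`C > 0` and `δ ∈ (0, 1)` such that for all `m`, `m'`, all `η`-Hölder functions
`φ₁, …, φ_{m+m'}`, all times `ℓ₁ ≤ … ≤ ℓ_m ≤ k₁ ≤ … ≤ k_{m'}` and all `N > 0`, the covariance of
`∏ i, φ_i ∘ T^{ℓ_i}` and `∏ j, φ_{m+j} ∘ T^{k_j + N}` is at most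
`C (∏ i, ‖φ_i‖_∞ + ∑ j, [φ_j]_η ∏_{i ≠ j} ‖φ_i‖_∞) δ^N`. -/
def MultipleDecorrelationOfOrder {X : Type*} [MetricSpace X] [MeasurableSpace X]
    (T : X → X) (μ : Measure X) (η : ℝ≥0) : Prop :=
  ∃ C δ : ℝ, 0 < C ∧ 0 < δ ∧ δ < 1 ∧
    ∀ (m m' : ℕ) (φ : Fin (m + m') → X → ℝ) (ℓ : Fin m → ℕ) (k : Fin m' → ℕ) (N : ℕ),
      (∀ i, MemHolder η (φ i)) → Monotone ℓ → Monotone k → (∀ i j, ℓ i ≤ k j) → 0 < N →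
      ProbabilityTheory.covariance
          (fun x => ∏ i : Fin m, φ (Fin.castAdd m' i) (T^[ℓ i] x))
          (fun x => ∏ j : Fin m', φ (Fin.natAdd m j) (T^[k j + N] x)) μ
        ≤ C * (∏ i, supNorm (φ i) +
            ∑ j, (nnHolderNorm η (φ j) : ℝ) * ∏ i ∈ Finset.univ.erase j, supNorm (φ i)) * δ ^ N

/-- The multiple decorrelation property: for each Hölder exponent `η ∈ (0, 1]` it holds, with
constants that may depend on `η`. -/
def MultipleDecorrelation {X : Type*} [MetricSpace X] [MeasurableSpace X]
    (T : X → X) (μ : Measure X) : Prop :=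
  ∀ η : ℝ≥0, 0 < η → η ≤ 1 → MultipleDecorrelationOfOrder T μ η

/-- The maps `θ x : X → X` are Hölder continuous, with an exponent and a constant that do not
depend on `x`. -/
def HolderFamily {X : Type*} [MetricSpace X] (θ : X → X → X) : Prop :=
  ∃ η : ℝ≥0, 0 < η ∧ ∃ A : ℝ≥0, ∀ x, HolderWith A η (θ x)

/-- `sup_z d(θ_x(z), θ_y(z)) ≤ C d(x, y) ^ η` for some `η > 0` and some `C`. -/
def HolderDependence {X : Type*} [MetricSpace X] (θ : X → X → X) : Prop :=
  ∃ η : ℝ, 0 < η ∧ ∃ C : ℝ, ∀ x y z, dist (θ x z) (θ y z) ≤ C * dist x y ^ η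

/-- `φ_τ = φ ∘ τ - ∫ φ ∘ τ dμ`, the composition of `φ` with `τ`, centered with respect to `μ`. -/
def centeredComp {X : Type*} [MeasurableSpace X] (μ : Measure X) (φ : X → ℝ) (τ : X → X) :
    X → ℝ :=
  fun y => φ (τ y) - ∫ z, φ (τ z) ∂μ

/-- The correlation `⟨f, T^k f⟩ = ∫ f · (f ∘ T^k) dμ`. -/
def autocorrelation {X : Type*} [MeasurableSpace X] (T : X → X) (μ : Measure X) (f : X → ℝ)
    (k : ℕ) : ℝ :=
  ∫ y, f y * f (T^[k] y) ∂μ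

/-- The asymptotic variance `σ²(f) = μ(f²) + 2 ∑_{k ≥ 1} ⟨f, T^k f⟩`. -/
def asymptoticVariance {X : Type*} [MeasurableSpace X] (T : X → X) (μ : Measure X)
    (f : X → ℝ) : ℝ :=
  (∫ y, f y ^ 2 ∂μ) + 2 * ∑' k : ℕ, autocorrelation T μ f (k + 1)

end

/-!
Write `F x = φ_{θ_x}` for the centered observable attached to the base point `x`. It is bounded,
`α`-Hölder in both variables for some `α ≤ 1`, and has mean zero for every `x`
(`exists_holder_centeredComp`). Expanding the square, the normalized second moment is
`1 / n * ∑ j, k ≤ n` of the correlations `G j k = ∫ F x (T^j x) F x (T^k x) dμ(x)`. Two estimates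
suffice, with some `q < 1`:

* `|G j (j + r)| ≤ B q ^ r` for `r ≥ 1`;
* `|G j (j + r) - A r| ≤ B q ^ j`, where `A r = ∫ ⟨F x, T^r (F x)⟩ dμ(x)`.

Indeed, summing along diagonals, Cesàro convergence on each diagonal and dominated convergence
across diagonals give the limit `A 0 + 2 ∑ A (r + 1)` (`tendsto_normalized_sum_square`), which is
the integral of the asymptotic variance.

If the observable were frozen at a point `a`, both estimates would be instances of decorrelation
for three functions, the first being an arbitrary Hölder weight `ρ` evaluated at time `0`
(`exists_integral_three_le`). To let `a = x` vary, choose a Lipschitz partition of unity at scale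
`1 / m` and freeze `a` at the centres of its pieces (`exists_integral_diagonal_le`). The error is
`O(m ^ (-α))`, and the number of pieces and their Hölder constants are polynomial in `m`, so that
`m` may grow exponentially with the gap while `δ ^ N` still wins.

The manifold structure is used only to bound the number of pieces: a compact Riemannian manifold is
covered by polynomially many balls of radius `1 / m`
(`hasPolynomialCovers_univ_of_isRiemannianManifold`), because the inverses of its charts are locally
Lipschitz for the Riemannian distance (`exists_riemannianEDist_le_edist_extChartAt`).
-/

/-! ### Charts of a Riemannian manifold -/

section RiemannianCharts

open Set Metric Manifold
open scoped ENNReal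

attribute [local instance] normedAddCommGroupTangentSpaceVectorSpace
attribute [local instance] normedSpaceTangentSpaceVectorSpace

/-- Around any point `x`, the inverse of the extended chart at `x` is Lipschitz for the Riemannian
distance: two points near `x` are joined by the image of the segment between their coordinates,
along which the derivative of the inverse chart is bounded. The segment stays in the range of the
chart because the range of a real model with corners is convex. -/
theorem exists_riemannianEDist_le_edist_extChartAt
    {E : Type*} [NormedAddCommGroup E] [NormedSpace ℝ E]
    {H : Type*} [TopologicalSpace H] (I : ModelWithCorners ℝ E H)
    {M : Type*} [TopologicalSpace M] [ChartedSpace H M]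
    [Bundle.RiemannianBundle (fun x : M => TangentSpace I x)]
    [IsManifold I 1 M] [IsContinuousRiemannianBundle E (fun x : M => TangentSpace I x)] (x : M) :
    ∃ C : ℝ≥0, ∃ U ∈ 𝓝 x, ∀ y ∈ U, ∀ z ∈ U,
      riemannianEDist I y z ≤ C * edist (extChartAt I x y) (extChartAt I x z) := by
  obtain ⟨C, hC⟩ : ∃ C : ℝ≥0, ∀ᶠ y in 𝓝[range I] (extChartAt I x x),
      ∀ v : TangentSpace 𝓘(ℝ, E) y, ‖mfderiv[range I] (extChartAt I x).symm y v‖ₑ ≤ C * ‖v‖ₑ := by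
    rcases eventually_enorm_mfderivWithin_symm_extChartAt_lt I x with ⟨C, C_pos, hC⟩
    refine ⟨C, ?_⟩
    filter_upwards [hC] with y hy v
    exact (ContinuousLinearMap.le_opENorm _ _).trans (mul_le_mul_left hy.le _)
  -- a ball around the base point whose trace on the convex range of `I` is controlled
  obtain ⟨r, r_pos, hr⟩ : ∃ r > 0,
      ball (extChartAt I x x) r ∩ range I ⊆ (extChartAt I x).target ∩
        {y | ∀ v : TangentSpace 𝓘(ℝ, E) y,
          ‖mfderiv[range I] (extChartAt I x).symm y v‖ₑ ≤ C * ‖v‖ₑ} :=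
    mem_nhdsWithin_iff.1 (Filter.inter_mem (extChartAt_target_mem_nhdsWithin x) hC)
  have A : (extChartAt I x) ⁻¹' (ball (extChartAt I x x) r ∩ range I) ∈ 𝓝 x := by
    apply extChartAt_preimage_mem_nhds_of_mem_nhdsWithin (by simp)
    rw [inter_comm]
    exact inter_mem_nhdsWithin _ (ball_mem_nhds _ r_pos)
  refine ⟨C, _, Filter.inter_mem A (chart_source_mem_nhds H x), ?_⟩
  rintro y ⟨hy, h'y⟩ z ⟨hz, h'z⟩
  -- the image under the inverse chart of the segment between the coordinates of `y` and `z`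
  let η := ContinuousAffineMap.lineMap (R := ℝ) (extChartAt I x y) (extChartAt I x z)
  set γ := (extChartAt I x).symm ∘ η
  have hη : Icc 0 1 ⊆ ⇑η ⁻¹' ((extChartAt I x).target ∩
        {y | ∀ v : TangentSpace 𝓘(ℝ, E) y,
          ‖mfderiv[range I] (extChartAt I x).symm y v‖ₑ ≤ C * ‖v‖ₑ}) := by
    simp only [← image_subset_iff, ContinuousAffineMap.coe_lineMap_eq,
     ← segment_eq_image_lineMap, η]
    apply Subset.trans _ hr
    exact ((convex_ball _ _).inter I.convex_range).segment_subset hy hz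
  simp only [preimage_inter, subset_inter_iff] at hη
  have η_smooth : CMDiff[Icc 0 1] 1 η := by
    apply ContMDiff.contMDiffOn
    rw [contMDiff_iff_contDiff]
    exact ContinuousAffineMap.contDiff _
  have : riemannianEDist I y z ≤ pathELength I γ 0 1 := by
    apply riemannianEDist_le_pathELength _ _ _ zero_le_one
    · exact (contMDiffOn_extChartAt_symm x).comp η_smooth hη.1
    · simp [γ, η, ContinuousAffineMap.coe_lineMap_eq, h'y]
    · simp [γ, η, ContinuousAffineMap.coe_lineMap_eq, h'z]
  apply this.trans
  rw [← lintegral_fderiv_lineMap_eq_edist, pathELength_eq_lintegral_mfderivWithin_Icc,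
    ← lintegral_const_mul' _ _ ENNReal.coe_ne_top]
  apply setLIntegral_mono' measurableSet_Icc (fun t ht ↦ ?_)
  have : mfderiv[Icc 0 1] γ t =
      (mfderiv[range I] (extChartAt I x).symm (η t)) ∘L (mfderiv[Icc 0 1] η t) := by
    apply mfderivWithin_comp
    · exact mdifferentiableWithinAt_extChartAt_symm (hη.1 ht)
    · exact η_smooth.mdifferentiableOn one_ne_zero t ht
    · exact hη.1.trans (preimage_mono (extChartAt_target_subset_range x))
    · rw [uniqueMDiffWithinAt_iff_uniqueDiffWithinAt]
      exact uniqueDiffOn_Icc zero_lt_one t ht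
  have : mfderiv[Icc 0 1] γ t 1 =
      (mfderiv[range I] (extChartAt I x).symm (η t)) (mfderiv[Icc 0 1] η t 1) := congr($this 1)
  rw [this]
  refine (hη.2 ht _).trans ?_
  simp only [mfderivWithin_eq_fderivWithin]
  exact le_of_eq rfl

end RiemannianCharts

/-! ### Covering numbers -/

section CoveringNumbers

/-- The covering numbers of `s` grow at most polynomially: for some `K` and `P` and all `m > 0`, at
most `K m ^ P` closed balls of radius `1 / m` cover `s`. -/
def HasPolynomialCovers {X : Type*} [MetricSpace X] (s : Set X) : Prop :=
  ∃ K P : ℕ, ∀ m : ℕ, 0 < m → ∃ t : Finset X, t.card ≤ K * m ^ P ∧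
    ∀ x ∈ s, ∃ y ∈ t, dist x y ≤ 1 / m

theorem HasPolynomialCovers.mono {X : Type*} [MetricSpace X] {s t : Set X}
    (ht : HasPolynomialCovers t) (h : s ⊆ t) : HasPolynomialCovers s := by
  obtain ⟨K, P, hK⟩ := ht
  refine ⟨K, P, fun m hm => ?_⟩
  obtain ⟨u, hu, hcov⟩ := hK m hm
  exact ⟨u, hu, fun x hx => hcov x (h hx)⟩

theorem HasPolynomialCovers.union {X : Type*} [MetricSpace X] {s t : Set X}
    (hs : HasPolynomialCovers s) (ht : HasPolynomialCovers t) : HasPolynomialCovers (s ∪ t) := by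
  classical
  obtain ⟨K, P, hK⟩ := hs
  obtain ⟨K', P', hK'⟩ := ht
  refine ⟨K + K', max P P', fun m hm => ?_⟩
  obtain ⟨u, hu, hcov⟩ := hK m hm
  obtain ⟨u', hu', hcov'⟩ := hK' m hm
  refine ⟨u ∪ u', ?_, ?_⟩
  · calc (u ∪ u').card ≤ K * m ^ P + K' * m ^ P' :=
          (Finset.card_union_le _ _).trans (add_le_add hu hu')
      _ ≤ K * m ^ max P P' + K' * m ^ max P P' := by
          gcongr
          · exact le_max_left _ _
          · exact le_max_right _ _
      _ = _ := by ring
  · rintro x (hx | hx)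
    · obtain ⟨y, hy, hxy⟩ := hcov x hx
      exact ⟨y, Finset.mem_union_left _ hy, hxy⟩
    · obtain ⟨y, hy, hxy⟩ := hcov' x hx
      exact ⟨y, Finset.mem_union_right _ hy, hxy⟩

/-- A set with bounded coordinates whose inverse is Lipschitz has polynomial covers: cut the
coordinate space into cubes of side `1 / (C m)` and pick a point of the set over each cube. -/
theorem hasPolynomialCovers_of_coordinates {X : Type*} [MetricSpace X] {s : Set X} {d : ℕ}
    (ψ : X → Fin d → ℝ) (C R : ℝ) (hψ : ∀ y ∈ s, ∀ z ∈ s, dist y z ≤ C * dist (ψ y) (ψ z))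
    (hR : ∀ y ∈ s, ‖ψ y‖ ≤ R) : HasPolynomialCovers s := by
  classical
  obtain ⟨C', hC'⟩ := exists_nat_ge (max C 1)
  obtain ⟨R', hR'⟩ := exists_nat_ge R
  have hC1 : (1 : ℝ) ≤ C' := (le_max_right _ _).trans hC'
  refine ⟨(2 * R' * C' + 1) ^ d, d, fun m hm => ?_⟩
  rcases s.eq_empty_or_nonempty with rfl | ⟨x₀, -⟩
  · exact ⟨∅, by simp, by simp⟩
  have hm0 : (0 : ℝ) < m := by exact_mod_cast hm
  let Q : ℝ := C' * m
  have hQ : 0 < Q := by positivity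
  let q : X → Fin d → ℤ := fun y i => ⌊Q * ψ y i⌋
  let J : Finset (Fin d → ℤ) :=
    Fintype.piFinset fun _ => Finset.Icc (-((R' * C' * m : ℕ) : ℤ)) ((R' * C' * m : ℕ) : ℤ)
  have hqJ : ∀ y ∈ s, q y ∈ J := by
    intro y hy
    refine Fintype.mem_piFinset.2 fun i => Finset.mem_Icc.2 ?_
    have h1 : |ψ y i| ≤ R' := ((norm_le_pi_norm (ψ y) i).trans (hR y hy)).trans hR'
    have h2 : |Q * ψ y i| ≤ ((R' * C' * m : ℕ) : ℝ) := by
      rw [abs_mul, abs_of_pos hQ]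
      push_cast
      calc Q * |ψ y i| ≤ Q * R' := by gcongr
        _ = _ := by simp only [Q]; ring
    obtain ⟨h3, h4⟩ := abs_le.1 h2
    constructor
    · exact Int.le_floor.2 (by push_cast at h3 ⊢; exact h3)
    · have := (Int.floor_le (Q * ψ y i)).trans h4
      exact_mod_cast this
  let g : (Fin d → ℤ) → X := fun k => if h : ∃ y ∈ s, q y = k then h.choose else x₀
  refine ⟨J.image g, ?_, fun x hx => ⟨g (q x), Finset.mem_image_of_mem _ (hqJ x hx), ?_⟩⟩
  · refine Finset.card_image_le.trans ?_
    have : J.card = (2 * (R' * C' * m) + 1) ^ d := by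
      simp only [J, Fintype.card_piFinset, Int.card_Icc, Finset.prod_const, Finset.card_univ,
        Fintype.card_fin]
      congr 1
      omega
    rw [this, ← mul_pow]
    gcongr
    nlinarith
  · have hex : ∃ y ∈ s, q y = q x := ⟨x, hx, rfl⟩
    have hg : g (q x) = hex.choose := dif_pos hex
    obtain ⟨h1, h2⟩ := hex.choose_spec
    rw [hg]
    set y := hex.choose
    have hd : dist (ψ x) (ψ y) ≤ 1 / Q := by
      refine (dist_pi_le_iff (by positivity)).2 fun i => ?_
      have : |Q * ψ y i - Q * ψ x i| < 1 := Int.abs_sub_lt_one_of_floor_eq_floor (congrFun h2 i)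
      rw [← mul_sub, abs_mul, abs_of_pos hQ] at this
      rw [dist_comm, Real.dist_eq, le_div_iff₀ hQ]
      linarith
    calc dist x y ≤ C * dist (ψ x) (ψ y) := hψ x hx y h1
      _ ≤ C' * (1 / Q) :=
          mul_le_mul ((le_max_left _ _).trans hC') hd dist_nonneg (by positivity)
      _ = 1 / m := by simp only [Q]; field_simp

/-- A compact Riemannian manifold has polynomial covers: near each point the inverse of the extended
chart is Lipschitz, and finitely many such neighbourhoods cover the manifold. -/
theorem hasPolynomialCovers_univ_of_isRiemannianManifold
    {E : Type*} [NormedAddCommGroup E] [NormedSpace ℝ E] [FiniteDimensional ℝ E]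
    {H : Type*} [TopologicalSpace H] (I : ModelWithCorners ℝ E H)
    {X : Type*} [MetricSpace X] [CompactSpace X] [ChartedSpace H X]
    [Bundle.RiemannianBundle (fun x : X => TangentSpace I x)]
    [IsManifold I 1 X] [IsContinuousRiemannianBundle E (fun x : X => TangentSpace I x)]
    [IsRiemannianManifold I X] : HasPolynomialCovers (Set.univ : Set X) := by
  refine isCompact_univ.induction_on ⟨0, 0, fun m _ => ⟨∅, by simp, by simp⟩⟩
    (fun s t h ht => ht.mono h) (fun s t hs ht => hs.union ht) fun x _ => ?_
  obtain ⟨C, U, hU, hC⟩ := exists_riemannianEDist_le_edist_extChartAt I x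
  let e : E ≃L[ℝ] (Fin (Module.finrank ℝ E) → ℝ) := ContinuousLinearEquiv.ofFinrankEq (by simp)
  have hball : (extChartAt I x) ⁻¹' Metric.ball (extChartAt I x x) 1 ∈ 𝓝 x :=
    (continuousAt_extChartAt x).preimage_mem_nhds (Metric.ball_mem_nhds _ one_pos)
  refine ⟨_, mem_nhdsWithin_of_mem_nhds (Filter.inter_mem hU hball),
    hasPolynomialCovers_of_coordinates (fun y => e (extChartAt I x y))
      (C * ‖(e.symm : (Fin (Module.finrank ℝ E) → ℝ) →L[ℝ] E)‖)
      (‖(e : E →L[ℝ] (Fin (Module.finrank ℝ E) → ℝ))‖ * (1 + ‖extChartAt I x x‖)) ?_ ?_⟩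
  · rintro y ⟨hy, -⟩ z ⟨hz, -⟩
    have h1 := hC y hy z hz
    rw [← IsRiemannianManifold.out (I := I) y z, edist_nndist, edist_nndist,
      ← ENNReal.coe_mul, ENNReal.coe_le_coe] at h1
    have h2 : dist y z ≤ C * dist (extChartAt I x y) (extChartAt I x z) := by exact_mod_cast h1
    refine h2.trans ?_
    rw [mul_assoc]
    gcongr
    have h3 := (e.symm : (Fin (Module.finrank ℝ E) → ℝ) →L[ℝ] E).le_opNorm
      (e (extChartAt I x y) - e (extChartAt I x z))
    rw [← map_sub] at h3
    simpa [dist_eq_norm] using h3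
  · rintro y ⟨-, hy⟩
    refine ((e : E →L[ℝ] (Fin (Module.finrank ℝ E) → ℝ)).le_opNorm _).trans ?_
    gcongr
    have : ‖extChartAt I x y - extChartAt I x x‖ < 1 := by
      simpa [dist_eq_norm] using hy
    have h4 := norm_add_le (extChartAt I x y - extChartAt I x x) (extChartAt I x x)
    rw [sub_add_cancel] at h4
    linarith

end CoveringNumbers

/-! ### Partitions of unity and testing on the diagonal -/

section Averaging

/-- A Lipschitz partition of unity subordinate to the balls of radius `2 ε` around the points of
an `ε`-net: normalize the tent functions `max 0 (2 ε - dist x a)`, whose sum is at least `ε`. -/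
theorem exists_lipschitz_partition {X : Type*} [MetricSpace X] {ε : ℝ} (hε : 0 < ε) (t : Finset X)
    (ht : ∀ x, ∃ a ∈ t, dist x a ≤ ε) :
    ∃ ρ : X → X → ℝ, (∀ a ∈ t, ∀ x, 0 ≤ ρ a x ∧ ρ a x ≤ 1) ∧ (∀ x, ∑ a ∈ t, ρ a x = 1) ∧
      (∀ a ∈ t, ∀ x, ρ a x ≠ 0 → dist x a ≤ 2 * ε) ∧
      ∀ a ∈ t, ∀ x y, |ρ a x - ρ a y| ≤ (t.card + 1) / ε * dist x y := by
  let h : X → X → ℝ := fun a x => max 0 (2 * ε - dist x a)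
  let S : X → ℝ := fun x => ∑ a ∈ t, h a x
  have h0 : ∀ a x, 0 ≤ h a x := fun a x => le_max_left _ _
  have hS : ∀ x, ε ≤ S x := by
    intro x
    obtain ⟨a, ha, hxa⟩ := ht x
    calc ε ≤ h a x := le_max_of_le_right (by linarith)
      _ ≤ S x := Finset.single_le_sum (fun b _ => h0 b x) ha
  have hSpos : ∀ x, 0 < S x := fun x => hε.trans_le (hS x)
  have hle : ∀ a ∈ t, ∀ x, h a x ≤ S x := fun a ha x =>
    Finset.single_le_sum (fun b _ => h0 b x) ha
  have hlip : ∀ a x y, |h a x - h a y| ≤ dist x y := by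
    intro a x y
    refine (abs_max_sub_max_le_max _ _ _ _).trans ?_
    rw [sub_self, abs_zero, max_eq_right (abs_nonneg _),
      show 2 * ε - dist x a - (2 * ε - dist y a) = dist y a - dist x a by ring, dist_comm x y]
    exact abs_dist_sub_le y x a
  have hSlip : ∀ x y, |S x - S y| ≤ t.card * dist x y := by
    intro x y
    simp only [S]
    rw [← Finset.sum_sub_distrib, ← nsmul_eq_mul]
    exact (Finset.abs_sum_le_sum_abs _ _).trans
      (Finset.sum_le_card_nsmul _ _ _ fun a _ => hlip a x y)
  refine ⟨fun a x => h a x / S x, fun a ha x => ⟨div_nonneg (h0 a x) (hSpos x).le,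
    (div_le_one (hSpos x)).2 (hle a ha x)⟩, fun x => ?_, fun a ha x hx => ?_, fun a ha x y => ?_⟩
  · rw [← Finset.sum_div]
    exact div_self (hSpos x).ne'
  · by_contra hcon
    refine hx ?_
    have : h a x = 0 := max_eq_left (by linarith [not_le.1 hcon])
    simp [this]
  · have hx := hSpos x
    have hy := hSpos y
    have key : h a x / S x - h a y / S y =
        ((h a x - h a y) + h a y / S y * (S y - S x)) / S x := by
      field_simp
      ring
    have hr0 : 0 ≤ h a y / S y := div_nonneg (h0 a y) hy.le
    have hr1 : h a y / S y ≤ 1 := (div_le_one hy).2 (hle a ha y)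
    have hnum : |(h a x - h a y) + h a y / S y * (S y - S x)| ≤ (t.card + 1) * dist x y := by
      refine (abs_add_le _ _).trans ?_
      rw [abs_mul, abs_of_nonneg hr0]
      have h1 := hlip a x y
      have h2 := hSlip y x
      rw [dist_comm] at h2
      have h3 : h a y / S y * |S y - S x| ≤ 1 * (t.card * dist x y) :=
        mul_le_mul hr1 h2 (abs_nonneg _) zero_le_one
      linarith
    rw [key, abs_div, abs_of_pos hx, div_mul_eq_mul_div _ ε]
    exact div_le_div₀ (by positivity) hnum hε (hS x)

/-- The Hölder interpolation between a bound and a Lipschitz bound. -/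
theorem le_mul_rpow_of_le_one_of_le_mul {u K d α : ℝ} (hK : 1 ≤ K) (hd : 0 ≤ d) (hα0 : 0 ≤ α)
    (hα1 : α ≤ 1) (h1 : u ≤ 1) (h2 : u ≤ K * d) : u ≤ K * d ^ α := by
  have hKd : 0 ≤ K * d := by positivity
  have h3 : u ≤ (K * d) ^ α := by
    rcases le_total (K * d) 1 with h | h
    · exact h2.trans (Real.self_le_rpow_of_le_one hKd h hα1)
    · exact h1.trans (Real.one_le_rpow h hα0)
  refine h3.trans ?_
  rw [Real.mul_rpow (by linarith) hd]
  gcongr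
  exact Real.rpow_le_self_of_one_le hK hα1

theorem holderWith_of_dist_le {X Y : Type*} [MetricSpace X] [MetricSpace Y] {K α : ℝ≥0}
    {f : X → Y} (hf : ∀ x y, dist (f x) (f y) ≤ K * dist x y ^ (α : ℝ)) : HolderWith K α f := by
  intro x y
  rw [edist_nndist, edist_nndist, ← ENNReal.coe_rpow_of_nonneg _ α.coe_nonneg, ← ENNReal.coe_mul,
    ENNReal.coe_le_coe, ← NNReal.coe_le_coe]
  push_cast
  exact hf x y

/-- Testing on the diagonal. If `g a` is `α`-Hölder in the parameter `a`, and its integrals against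
`α`-Hölder weights with values in `[0, 1]` and Hölder constant `K` are `O(K δ ^ N)`, then the
integral of `g x x` is exponentially small in `N`. The weights are a partition of unity at scale
`1 / m`, and `m` grows exponentially in `N`, slowly enough for the polynomially many weights, with
their polynomially large Hölder constants, to be beaten by `δ ^ N`. -/
theorem exists_integral_diagonal_le {X : Type*} [MetricSpace X] [CompactSpace X]
    [MeasurableSpace X] [BorelSpace X] (μ : Measure X) [IsProbabilityMeasure μ]
    (hX : HasPolynomialCovers (Set.univ : Set X)) {α : ℝ≥0} (hα0 : 0 < α) (hα1 : α ≤ 1)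
    {M δ : ℝ} (hM : 0 ≤ M) (hδ0 : 0 < δ) (hδ1 : δ < 1) :
    ∃ B q : ℝ, 0 ≤ B ∧ 0 ≤ q ∧ q < 1 ∧ ∀ (N : ℕ) (g : X → X → ℝ),
      Measurable (Function.uncurry g) → (∀ a x, |g a x| ≤ M) →
      (∀ a b x, |g a x - g b x| ≤ M * dist a b ^ (α : ℝ)) →
      (∀ (a : X) (K : ℝ≥0) (ρ : X → ℝ), 1 ≤ K → (∀ x, 0 ≤ ρ x ∧ ρ x ≤ 1) → HolderWith K α ρ →
        |∫ x, ρ x * g a x ∂μ| ≤ M * K * δ ^ N) →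
      |∫ x, g x x ∂μ| ≤ B * q ^ N := by
  obtain ⟨K, P, hKP⟩ := hX
  have hα0' : (0 : ℝ) < α := hα0
  have hα1' : (α : ℝ) ≤ 1 := hα1
  -- the choice of `κ` balances the number and size of the weights, of order `κ ^ (-(2 P + 1) N)`,
  -- against `δ ^ N`
  set κ : ℝ := δ ^ (1 / (2 * P + 2 : ℝ)) with hκ
  have hκ0 : 0 < κ := Real.rpow_pos_of_pos hδ0 _
  have hκ1 : κ < 1 := Real.rpow_lt_one hδ0.le hδ1 (by positivity)
  have hκδ : κ ^ (2 * P + 2) = δ := by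
    rw [hκ, ← Real.rpow_natCast, ← Real.rpow_mul hδ0.le]
    push_cast
    rw [one_div, inv_mul_cancel₀ (by positivity), Real.rpow_one]
  have hq : κ ≤ κ ^ (α : ℝ) := Real.self_le_rpow_of_le_one hκ0.le hκ1.le hα1'
  refine ⟨M * (K * (K + 1)) * 2 ^ (2 * P + 1) + 2 * M, κ ^ (α : ℝ), by positivity, by positivity,
    Real.rpow_lt_one hκ0.le hκ1 hα0', fun N g hgm hgM hgα hgδ => ?_⟩
  have hκN : 0 < κ ^ N := by positivity
  have hκN1 : κ ^ N ≤ 1 := pow_le_one₀ hκ0.le hκ1.le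
  -- the scale
  set m : ℕ := ⌈(κ ^ N)⁻¹⌉₊ with hm
  have hm1 : (κ ^ N)⁻¹ ≤ m := Nat.le_ceil _
  have hinv : 1 ≤ (κ ^ N)⁻¹ := (one_le_inv₀ hκN).2 hκN1
  have hm2 : (m : ℝ) ≤ 2 * (κ ^ N)⁻¹ := by
    have := (Nat.ceil_lt_add_one (by positivity : 0 ≤ (κ ^ N)⁻¹)).le
    linarith
  have hm1' : (1 : ℝ) ≤ m := hinv.trans hm1
  have hm0 : 0 < m := by
    have : (0 : ℝ) < m := by linarith
    exact_mod_cast this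
  have hminv : 1 / (m : ℝ) ≤ κ ^ N := by
    rw [one_div]
    exact inv_le_of_inv_le₀ hκN hm1
  obtain ⟨t, htc, ht⟩ := hKP m hm0
  obtain ⟨ρ, hρ01, hρ1, hρsupp, hρlip⟩ := exists_lipschitz_partition
    (by positivity : 0 < 1 / (m : ℝ)) t fun x => ht x trivial
  have htc' : (t.card : ℝ) ≤ K * (m : ℝ) ^ P := by exact_mod_cast htc
  set Kρ : ℝ≥0 := (t.card + 1) * m with hKρ
  have hKρ1 : 1 ≤ Kρ := by
    rw [← NNReal.coe_le_coe]
    push_cast [hKρ]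
    nlinarith [(Nat.cast_nonneg t.card : (0 : ℝ) ≤ t.card)]
  have hρH : ∀ a ∈ t, HolderWith Kρ α (ρ a) := by
    intro a ha
    refine holderWith_of_dist_le fun x y => ?_
    rw [Real.dist_eq]
    refine le_mul_rpow_of_le_one_of_le_mul hKρ1 dist_nonneg hα0'.le hα1' ?_ ?_
    · have h1 := hρ01 a ha x
      have h2 := hρ01 a ha y
      exact abs_sub_le_iff.2 ⟨by linarith, by linarith⟩
    · have := hρlip a ha x y
      rw [hKρ]
      push_cast
      simpa using this
  have hdiag : Measurable fun x => g x x := hgm.comp (measurable_id.prodMk measurable_id)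
  have hint : Integrable (fun x => g x x) μ :=
    Integrable.of_bound hdiag.aestronglyMeasurable M (ae_of_all _ fun x => hgM x x)
  have hint' : ∀ a ∈ t, Integrable (fun x => ρ a x * g a x) μ := by
    intro a ha
    have hc : Measurable (ρ a) := ((hρH a ha).continuous hα0).measurable
    have hga : Measurable (g a) := hgm.comp measurable_prodMk_left
    refine Integrable.of_bound (hc.mul hga).aestronglyMeasurable M (ae_of_all _ fun x => ?_)
    rw [Real.norm_eq_abs, abs_mul, abs_of_nonneg (hρ01 a ha x).1]
    calc ρ a x * |g a x| ≤ 1 * M :=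
          mul_le_mul (hρ01 a ha x).2 (hgM a x) (abs_nonneg _) zero_le_one
      _ = M := one_mul M
  -- freezing the parameter at the centres of the balls
  have hfreeze : |∫ x, (g x x - ∑ a ∈ t, ρ a x * g a x) ∂μ| ≤ 2 * M * (κ ^ (α : ℝ)) ^ N := by
    have hpt : ∀ x, ‖g x x - ∑ a ∈ t, ρ a x * g a x‖ ≤ 2 * M * (κ ^ (α : ℝ)) ^ N := by
      intro x
      have h1 : g x x - ∑ a ∈ t, ρ a x * g a x = ∑ a ∈ t, ρ a x * (g x x - g a x) := by
        simp only [mul_sub, Finset.sum_sub_distrib]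
        rw [← Finset.sum_mul, hρ1, one_mul]
      rw [h1]
      have h2 : ∀ a ∈ t, ‖ρ a x * (g x x - g a x)‖ ≤ ρ a x * (2 * M * (κ ^ (α : ℝ)) ^ N) := by
        intro a ha
        rw [norm_mul, Real.norm_eq_abs, Real.norm_eq_abs, abs_of_nonneg (hρ01 a ha x).1]
        by_cases h0 : ρ a x = 0
        · simp [h0]
        have hd : dist x a ≤ 2 * κ ^ N :=
          (hρsupp a ha x h0).trans (by linarith)
        refine mul_le_mul_of_nonneg_left ((hgα x a x).trans ?_) (hρ01 a ha x).1
        calc M * dist x a ^ (α : ℝ) ≤ M * (2 * κ ^ N) ^ (α : ℝ) := by gcongr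
          _ = M * (2 ^ (α : ℝ) * (κ ^ (α : ℝ)) ^ N) := by
              rw [Real.mul_rpow (by norm_num) hκN.le, ← Real.rpow_natCast κ N,
                ← Real.rpow_natCast (κ ^ (α : ℝ)) N, ← Real.rpow_mul hκ0.le,
                ← Real.rpow_mul hκ0.le, mul_comm (N : ℝ)]
          _ ≤ M * (2 * (κ ^ (α : ℝ)) ^ N) := by
              gcongr
              exact Real.rpow_le_self_of_one_le (by norm_num) hα1'
          _ = _ := by ring
      refine (norm_sum_le_of_le t h2).trans ?_
      rw [← Finset.sum_mul, hρ1, one_mul]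
    have := norm_integral_le_of_norm_le_const (μ := μ) (ae_of_all _ hpt)
    simpa using this
  have hsum : |∑ a ∈ t, ∫ x, ρ a x * g a x ∂μ| ≤
      M * (K * (K + 1)) * 2 ^ (2 * P + 1) * (κ ^ (α : ℝ)) ^ N := by
    have h1 : |∑ a ∈ t, ∫ x, ρ a x * g a x ∂μ| ≤ t.card * (M * Kρ * δ ^ N) := by
      rw [← nsmul_eq_mul]
      refine (Finset.abs_sum_le_sum_abs _ _).trans (Finset.sum_le_card_nsmul _ _ _ fun a ha => ?_)
      exact hgδ a Kρ (ρ a) hKρ1 (hρ01 a ha) (hρH a ha)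
    have hmP : (1 : ℝ) ≤ (m : ℝ) ^ P := one_le_pow₀ hm1'
    have h2 : (Kρ : ℝ) ≤ (K + 1) * (m : ℝ) ^ (P + 1) := by
      rw [hKρ]
      push_cast
      rw [pow_succ, ← mul_assoc]
      gcongr
      linarith
    calc |∑ a ∈ t, ∫ x, ρ a x * g a x ∂μ| ≤ t.card * (M * Kρ * δ ^ N) := h1
      _ ≤ (K * (m : ℝ) ^ P) * (M * ((K + 1) * (m : ℝ) ^ (P + 1)) * δ ^ N) := by gcongr
      _ = M * (K * (K + 1)) * (m : ℝ) ^ (2 * P + 1) * δ ^ N := by ring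
      _ ≤ M * (K * (K + 1)) * (2 * (κ ^ N)⁻¹) ^ (2 * P + 1) * δ ^ N := by gcongr
      _ = M * (K * (K + 1)) * 2 ^ (2 * P + 1) * κ ^ N := by
          have h3 : δ ^ N = (κ ^ N) ^ (2 * P + 1) * κ ^ N := by
            rw [← hκδ]
            ring
          rw [h3, mul_pow, inv_pow]
          field_simp
      _ ≤ _ := by gcongr
  have hsplit : ∫ x, g x x ∂μ =
      ∫ x, (g x x - ∑ a ∈ t, ρ a x * g a x) ∂μ + ∑ a ∈ t, ∫ x, ρ a x * g a x ∂μ := by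
    rw [integral_sub hint (integrable_finsetSum _ hint'), integral_finsetSum _ hint']
    ring
  rw [hsplit]
  refine (abs_add_le _ _).trans ?_
  linarith

end Averaging

/-! ### Decorrelation of three functions -/

section Decorrelation

theorem supNorm_nonneg {X : Type*} (f : X → ℝ) : 0 ≤ supNorm f :=
  Real.iSup_nonneg fun _ => abs_nonneg _

theorem supNorm_le {X : Type*} {f : X → ℝ} {L : ℝ} (hL : 0 ≤ L) (h : ∀ x, |f x| ≤ L) :
    supNorm f ≤ L :=
  Real.iSup_le h hL

/-- The bound on the right-hand side of the decorrelation inequality for three functions bounded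
by `L` and with Hölder constants at most `K`. -/
theorem prod_supNorm_add_sum_le {X : Type*} [MetricSpace X] {α : ℝ≥0} {L K : ℝ≥0}
    {ι : Type*} [Fintype ι] [DecidableEq ι] (hι : Fintype.card ι = 3)
    (f : ι → X → ℝ) (hL : ∀ i x, |f i x| ≤ L) (hK : ∀ i, HolderWith K α (f i)) :
    ∏ i, supNorm (f i) +
        ∑ j, (nnHolderNorm α (f j) : ℝ) * ∏ i ∈ Finset.univ.erase j, supNorm (f i) ≤
      (L : ℝ) ^ 3 + 3 * (K * (L : ℝ) ^ 2) := by
  have hs : ∀ i, supNorm (f i) ≤ L := fun i => supNorm_le L.2 (hL i)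
  refine add_le_add ?_ ?_
  · refine (Finset.prod_le_prod (fun i _ => supNorm_nonneg _) fun i _ => hs i).trans ?_
    rw [Finset.prod_const, Finset.card_univ, hι]
  · refine (Finset.sum_le_card_nsmul _ _ (K * (L : ℝ) ^ 2) fun j _ => ?_).trans ?_
    · have h1 : (nnHolderNorm α (f j) : ℝ) ≤ K := by exact_mod_cast (hK j).nnholderNorm_le
      have h2 : ∏ i ∈ Finset.univ.erase j, supNorm (f i) ≤ (L : ℝ) ^ 2 := by
        refine (Finset.prod_le_prod (fun i _ => supNorm_nonneg _) fun i _ => hs i).trans ?_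
        rw [Finset.prod_const, Finset.card_erase_of_mem (Finset.mem_univ j), Finset.card_univ, hι]
      exact mul_le_mul h1 h2 (Finset.prod_nonneg fun i _ => supNorm_nonneg _) K.2
    · rw [Finset.card_univ, hι, nsmul_eq_mul]
      norm_num

theorem holderWith_neg {X : Type*} [MetricSpace X] {K α : ℝ≥0} {f : X → ℝ}
    (hf : HolderWith K α f) : HolderWith K α (fun x => -f x) := by
  intro x y
  rw [edist_neg_neg]
  exact hf x y

/-- The covariance of bounded measurable functions. -/
theorem covariance_eq_of_bounded {X : Type*} [MeasurableSpace X] {μ : Measure X}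
    [IsProbabilityMeasure μ] {f g : X → ℝ} (hf : Measurable f) (hg : Measurable g) {A B : ℝ}
    (hA : ∀ x, |f x| ≤ A) (hB : ∀ x, |g x| ≤ B) :
    ProbabilityTheory.covariance f g μ = ∫ x, f x * g x ∂μ - (∫ x, f x ∂μ) * ∫ x, g x ∂μ :=
  ProbabilityTheory.covariance_eq_sub
    (MemLp.of_bound hf.aestronglyMeasurable A (ae_of_all _ hA))
    (MemLp.of_bound hg.aestronglyMeasurable B (ae_of_all _ hB))

theorem abs_mul_le_of_abs_le {a b A B : ℝ} (ha : |a| ≤ A) (hb : |b| ≤ B) : |a * b| ≤ A * B := by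
  rw [abs_mul]
  exact mul_le_mul ha hb (abs_nonneg _) ((abs_nonneg _).trans ha)

theorem integral_comp_iterate {X : Type*} [MeasurableSpace X] {μ : Measure X} {T : X → X}
    (hT : MeasurePreserving T μ μ) {f : X → ℝ} (hf : Measurable f) (n : ℕ) :
    ∫ x, f (T^[n] x) ∂μ = ∫ x, f x ∂μ := by
  have h := hT.iterate n
  rw [← integral_map h.measurable.aemeasurable (by rw [h.map_eq]; exact hf.aestronglyMeasurable),
    h.map_eq]

/-- The decorrelation property for three functions, at times `0 ≤ j < j + r`, as a two-sided bound.
If the last function is centered, the correlation is exponentially small in the last gap `r`; and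
the first function separates from the other two with an error exponentially small in the first
gap `j`. -/
theorem exists_integral_three_le {X : Type*} [MetricSpace X] [MeasurableSpace X] [BorelSpace X]
    {μ : Measure X} [IsProbabilityMeasure μ] {T : X → X} {α : ℝ≥0} (hα : 0 < α)
    (hT : MeasurePreserving T μ μ) (hdec : MultipleDecorrelationOfOrder T μ α) :
    ∃ C δ : ℝ, 0 < C ∧ 0 < δ ∧ δ < 1 ∧ ∀ (L K : ℝ≥0) (ρ u v : X → ℝ),
      (∀ x, |ρ x| ≤ L) → (∀ x, |u x| ≤ L) → (∀ x, |v x| ≤ L) →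
      HolderWith K α ρ → HolderWith K α u → HolderWith K α v → ∀ j r : ℕ,
      (0 < r → ∫ x, v x ∂μ = 0 →
        |∫ x, ρ x * (u (T^[j] x) * v (T^[j + r] x)) ∂μ| ≤
          C * (L ^ 3 + 3 * (K * L ^ 2)) * δ ^ r) ∧
      (0 < j →
        |∫ x, ρ x * (u (T^[j] x) * v (T^[j + r] x) - ∫ y, u y * v (T^[r] y) ∂μ) ∂μ| ≤
          C * (L ^ 3 + 3 * (K * L ^ 2)) * δ ^ j) := by
  obtain ⟨C, δ, hC, hδ0, hδ1, h⟩ := hdec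
  refine ⟨C, δ, hC, hδ0, hδ1, ?_⟩
  intro L K ρ u v hρL huL hvL hρ hu hv j r
  have hum := (hu.continuous hα).measurable
  have hvm := (hv.continuous hα).measurable
  have hTj := (hT.iterate j).measurable
  have hTr := (hT.iterate r).measurable
  have hTjr := (hT.iterate (j + r)).measurable
  have bound : ∀ f : Fin 3 → X → ℝ, (∀ i x, |f i x| ≤ L) → (∀ i, HolderWith K α (f i)) → ∀ N : ℕ,
      C * (∏ i, supNorm (f i) +
        ∑ j, (nnHolderNorm α (f j) : ℝ) * ∏ i ∈ Finset.univ.erase j, supNorm (f i)) * δ ^ N ≤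
      C * (L ^ 3 + 3 * (K * L ^ 2)) * δ ^ N := by
    intro f h1 h2 N
    have := prod_supNorm_add_sum_le (by simp) f h1 h2
    gcongr
  -- a one-sided bound suffices: the first function may be replaced by its opposite
  have two_sided : ∀ (w : X → ℝ) (E : ℝ), (∀ σ : X → ℝ, (∀ x, |σ x| ≤ L) → HolderWith K α σ →
      ∫ x, σ x * w x ∂μ ≤ E) → |∫ x, ρ x * w x ∂μ| ≤ E := by
    intro w E hw
    refine abs_le'.2 ⟨hw ρ hρL hρ, ?_⟩
    have := hw (fun x => -ρ x) (fun x => by rw [abs_neg]; exact hρL x) (holderWith_neg hρ)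
    simpa only [neg_mul, integral_neg] using this
  constructor
  · intro hr hv0
    refine two_sided _ _ fun σ hσL hσ => ?_
    have hσm := (hσ.continuous hα).measurable
    have hfL : ∀ i x, |(![σ, u, v] : Fin 3 → X → ℝ) i x| ≤ L := by
      intro i x
      fin_cases i
      exacts [hσL x, huL x, hvL x]
    have hfK : ∀ i, HolderWith K α ((![σ, u, v] : Fin 3 → X → ℝ) i) := by
      intro i
      fin_cases i
      exacts [hσ, hu, hv]
    have hcov := (h 2 1 ![σ, u, v] ![0, j] ![j] r (fun i => (hfK i).memHolder)
      (by intro a b; fin_cases a <;> fin_cases b <;> simp)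
      (Subsingleton.monotone _)
      (by intro a b; fin_cases a <;> fin_cases b <;> simp) hr).trans (bound _ hfL hfK r)
    have e1 : (fun x => ∏ i : Fin 2,
        (![σ, u, v] : Fin 3 → X → ℝ) (Fin.castAdd 1 i) (T^[(![0, j] : Fin 2 → ℕ) i] x)) =
        fun x => σ x * u (T^[j] x) := by
      funext x
      rw [Fin.prod_univ_two]
      rfl
    have e2 : (fun x => ∏ i : Fin 1,
        (![σ, u, v] : Fin 3 → X → ℝ) (Fin.natAdd 2 i) (T^[(![j] : Fin 1 → ℕ) i + r] x)) =
        fun x => v (T^[j + r] x) := by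
      funext x
      rw [Fin.prod_univ_one]
      rfl
    rw [e1, e2, covariance_eq_of_bounded (f := fun x => σ x * u (T^[j] x))
      (g := fun x => v (T^[j + r] x)) (hσm.mul (hum.comp hTj)) (hvm.comp hTjr)
      (fun x => abs_mul_le_of_abs_le (hσL x) (huL _)) (fun x => hvL _),
      integral_comp_iterate hT hvm, hv0, mul_zero, sub_zero] at hcov
    simpa only [mul_assoc] using hcov
  · intro hj
    refine two_sided _ _ fun σ hσL hσ => ?_
    have hσm := (hσ.continuous hα).measurable
    have hfL : ∀ i x, |(![σ, u, v] : Fin 3 → X → ℝ) i x| ≤ L := by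
      intro i x
      fin_cases i
      exacts [hσL x, huL x, hvL x]
    have hfK : ∀ i, HolderWith K α ((![σ, u, v] : Fin 3 → X → ℝ) i) := by
      intro i
      fin_cases i
      exacts [hσ, hu, hv]
    have hcov := (h 1 2 ![σ, u, v] ![0] ![0, r] j (fun i => (hfK i).memHolder)
      (Subsingleton.monotone _)
      (by intro a b; fin_cases a <;> fin_cases b <;> simp)
      (by intro a b; fin_cases a; fin_cases b <;> simp) hj).trans (bound _ hfL hfK j)
    have e1 : (fun x => ∏ i : Fin 1,
        (![σ, u, v] : Fin 3 → X → ℝ) (Fin.castAdd 2 i) (T^[(![0] : Fin 1 → ℕ) i] x)) = σ := by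
      funext x
      rw [Fin.prod_univ_one]
      rfl
    have e2 : (fun x => ∏ i : Fin 2,
        (![σ, u, v] : Fin 3 → X → ℝ) (Fin.natAdd 1 i) (T^[(![0, r] : Fin 2 → ℕ) i + j] x)) =
        fun x => u (T^[j] x) * v (T^[j + r] x) := by
      funext x
      rw [Fin.prod_univ_two]
      simp only [Matrix.cons_val_zero, Matrix.cons_val_one, zero_add, add_comm r j]
      rfl
    have huv : ∫ x, u (T^[j] x) * v (T^[j + r] x) ∂μ = ∫ y, u y * v (T^[r] y) ∂μ := by
      rw [← integral_comp_iterate hT (f := fun y => u y * v (T^[r] y))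
        (hum.mul (hvm.comp hTr)) j]
      simp only [← Function.iterate_add_apply, add_comm r j]
    have huvL : ∀ x, |u (T^[j] x) * v (T^[j + r] x)| ≤ L * L :=
      fun x => abs_mul_le_of_abs_le (huL _) (hvL _)
    have huvm : Measurable fun x => u (T^[j] x) * v (T^[j + r] x) :=
      (hum.comp hTj).mul (hvm.comp hTjr)
    rw [e1, e2, covariance_eq_of_bounded hσm huvm hσL huvL, huv] at hcov
    have i1 : Integrable (fun x => σ x * (u (T^[j] x) * v (T^[j + r] x))) μ :=
      Integrable.of_bound (hσm.mul huvm).aestronglyMeasurable (L * (L * L))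
        (ae_of_all _ fun x => abs_mul_le_of_abs_le (hσL x) (huvL x))
    have i2 : Integrable (fun x => σ x * ∫ y, u y * v (T^[r] y) ∂μ) μ :=
      (Integrable.of_bound hσm.aestronglyMeasurable L (ae_of_all _ hσL)).mul_const _
    simp only [mul_sub]
    rw [integral_sub i1 i2, integral_mul_const]
    exact hcov

end Decorrelation

/-! ### Sums over squares by diagonals -/

section DoubleSums

open Filter

/-- Summing a symmetric kernel over a square by diagonals. -/
theorem sum_range_sum_range_eq_diagonals (a : ℕ → ℕ → ℝ) (ha : ∀ j k, a j k = a k j) (n : ℕ) :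
    ∑ j ∈ Finset.range n, ∑ k ∈ Finset.range n, a j k =
      ∑ j ∈ Finset.range n, a j j +
        2 * ∑ r ∈ Finset.range n, ∑ j ∈ Finset.range (n - (r + 1)), a j (j + (r + 1)) := by
  induction n with
  | zero => simp
  | succ n ih =>
    have h1 : ∑ r ∈ Finset.range (n + 1), ∑ j ∈ Finset.range (n + 1 - (r + 1)), a j (j + (r + 1)) =
        ∑ r ∈ Finset.range n, ∑ j ∈ Finset.range (n - (r + 1)), a j (j + (r + 1)) +
          ∑ j ∈ Finset.range n, a j n := by
      rw [Finset.sum_range_succ, ← Finset.sum_range_reflect (fun j => a j n),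
        ← Finset.sum_add_distrib]
      simp only [Nat.sub_self, Finset.range_zero, Finset.sum_empty, add_zero]
      refine Finset.sum_congr rfl fun r hr => ?_
      have hr := Finset.mem_range.1 hr
      rw [show n + 1 - (r + 1) = n - (r + 1) + 1 by omega, Finset.sum_range_succ]
      congr 2 <;> omega
    have h2 : ∑ k ∈ Finset.range n, a n k = ∑ j ∈ Finset.range n, a j n :=
      Finset.sum_congr rfl fun j _ => ha _ _
    rw [h1, Finset.sum_range_succ, Finset.sum_range_succ (fun j => a j j)]
    simp only [Finset.sum_range_succ, Finset.sum_add_distrib]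
    rw [ih, h2]
    ring

/-- Cesàro averages over the first `n - s` terms, still normalized by `n`. -/
theorem tendsto_cesaro_sub {u : ℕ → ℝ} {l : ℝ} (hu : Tendsto u atTop (𝓝 l)) (s : ℕ) :
    Tendsto (fun n : ℕ => (n : ℝ)⁻¹ * ∑ j ∈ Finset.range (n - s), u j) atTop (𝓝 l) := by
  have h1 := hu.cesaro.comp (tendsto_sub_atTop_nat s)
  have h2 : Tendsto (fun n : ℕ => 1 - (s : ℝ) / n) atTop (𝓝 (1 - 0)) :=
    tendsto_const_nhds.sub (tendsto_const_div_atTop_nhds_zero_nat (s : ℝ))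
  have h3 := h2.mul h1
  rw [sub_zero, one_mul] at h3
  refine h3.congr' ?_
  filter_upwards [eventually_gt_atTop s] with n hn
  have hn0 : (n : ℝ) ≠ 0 := by
    have : n ≠ 0 := by omega
    exact_mod_cast this
  have hns : ((n - s : ℕ) : ℝ) ≠ 0 := by
    have : n - s ≠ 0 := by omega
    exact_mod_cast this
  have hc : ((n - s : ℕ) : ℝ) = n - s := Nat.cast_sub hn.le
  simp only [Function.comp_apply]
  rw [show 1 - (s : ℝ) / n = ((n - s : ℕ) : ℝ) / n by rw [hc]; field_simp]
  field_simp

/-- If a symmetric kernel decays geometrically away from the diagonal, uniformly along it, and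
converges along each diagonal, then its normalized sums over squares converge to the sum of the
limits over all diagonals. -/
theorem tendsto_normalized_sum_square {a : ℕ → ℕ → ℝ} {A : ℕ → ℝ} {B q : ℝ}
    (ha : ∀ j k, a j k = a k j) (hq0 : 0 ≤ q) (hq1 : q < 1)
    (hB : ∀ j r, |a j (j + (r + 1))| ≤ B * q ^ (r + 1))
    (hA : ∀ r, Tendsto (fun j => a j (j + r)) atTop (𝓝 (A r))) :
    Tendsto (fun n : ℕ => 1 / (n : ℝ) * ∑ j ∈ Finset.range n, ∑ k ∈ Finset.range n, a j k) atTop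
      (𝓝 (A 0 + 2 * ∑' r, A (r + 1))) := by
  let f : ℕ → ℕ → ℝ := fun n r =>
    (n : ℝ)⁻¹ * ∑ j ∈ Finset.range (n - (r + 1)), a j (j + (r + 1))
  have hf : Tendsto (fun n => ∑' r, f n r) atTop (𝓝 (∑' r, A (r + 1))) := by
    refine tendsto_tsum_of_dominated_convergence (bound := fun r => B * q ^ (r + 1)) ?_
      (fun r => tendsto_cesaro_sub (hA (r + 1)) (r + 1)) (Eventually.of_forall fun n r => ?_)
    · exact ((summable_nat_add_iff 1).2 (summable_geometric_of_lt_one hq0 hq1)).mul_left B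
    · have hB0 : 0 ≤ B * q ^ (r + 1) := (abs_nonneg _).trans (hB 0 r)
      have h1 : |∑ j ∈ Finset.range (n - (r + 1)), a j (j + (r + 1))| ≤ n * (B * q ^ (r + 1)) := by
        refine (Finset.abs_sum_le_sum_abs _ _).trans
          ((Finset.sum_le_card_nsmul _ _ _ fun j _ => hB j r).trans ?_)
        rw [Finset.card_range, nsmul_eq_mul]
        gcongr
        omega
      rw [Real.norm_eq_abs, abs_mul, abs_of_nonneg (by positivity : (0 : ℝ) ≤ (n : ℝ)⁻¹)]
      rcases Nat.eq_zero_or_pos n with rfl | hn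
      · simpa using hB0
      · have hn0 : (0 : ℝ) < n := by exact_mod_cast hn
        rw [inv_mul_le_iff₀ hn0]
        exact h1
  have hd : Tendsto (fun n : ℕ => (n : ℝ)⁻¹ * ∑ j ∈ Finset.range n, a j j) atTop (𝓝 (A 0)) :=
    (hA 0).cesaro
  refine (hd.add (hf.const_mul 2)).congr fun n => ?_
  have hfin : ∑' r, f n r = ∑ r ∈ Finset.range n, f n r := by
    refine tsum_eq_sum fun r hr => ?_
    have hr : n ≤ r := by simpa using hr
    simp only [f]
    rw [show n - (r + 1) = 0 by omega]
    simp
  rw [hfin, sum_range_sum_range_eq_diagonals a ha n, ← Finset.mul_sum]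
  ring

end DoubleSums

/-! ### Variance asymptotics for Hölder families -/

section Families

open Filter

theorem HolderWith.abs_sub_le {X : Type*} [MetricSpace X] {K α : ℝ≥0} {f : X → ℝ}
    (hf : HolderWith K α f) (x y : X) : |f x - f y| ≤ K * dist x y ^ (α : ℝ) := by
  rw [← Real.dist_eq]
  exact hf.dist_le x y

theorem abs_mul_sub_mul_le {a b a' b' L e : ℝ} (ha : |a| ≤ L) (hb' : |b'| ≤ L)
    (h1 : |a - a'| ≤ L * e) (h2 : |b - b'| ≤ L * e) : |a * b - a' * b'| ≤ 2 * L ^ 2 * e := by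
  have h : a * b - a' * b' = a * (b - b') + (a - a') * b' := by ring
  rw [h]
  have h3 := abs_mul_le_of_abs_le ha h2
  have h4 := abs_mul_le_of_abs_le h1 hb'
  refine (abs_add_le _ _).trans ?_
  linarith

theorem sum_Icc_one_eq_sum_range (f : ℕ → ℝ) (n : ℕ) :
    ∑ k ∈ Finset.Icc 1 n, f k = ∑ k ∈ Finset.range n, f (k + 1) := by
  induction n with
  | zero => simp
  | succ n ih => rw [Finset.sum_Icc_succ_top (by omega), Finset.sum_range_succ, ih]

/-- The variance asymptotics for a Hölder family of Hölder observables `F x`, one for each base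
point `x`, with the orbit sums of `F x` taken along the orbit of `x` itself. -/
theorem tendsto_variance_of_holder_family {X : Type*} [MetricSpace X] [CompactSpace X]
    [MeasurableSpace X] [BorelSpace X] {μ : Measure X} [IsProbabilityMeasure μ] {T : X → X}
    (hX : HasPolynomialCovers (Set.univ : Set X)) (hT : MeasurePreserving T μ μ)
    {α : ℝ≥0} (hα0 : 0 < α) (hα1 : α ≤ 1) (hdec : MultipleDecorrelationOfOrder T μ α)
    {F : X → X → ℝ} {L : ℝ≥0} (hL1 : 1 ≤ L) (hFL : ∀ a x, |F a x| ≤ L)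
    (hFx : ∀ a, HolderWith L α (F a)) (hFa : ∀ x, HolderWith L α fun a => F a x)
    (hF0 : ∀ a, ∫ x, F a x ∂μ = 0) :
    (∀ x, Summable fun k : ℕ => autocorrelation T μ (F x) (k + 1)) ∧
    Integrable (fun x => asymptoticVariance T μ (F x)) μ ∧
    (∀ n : ℕ, Integrable (fun x =>
      1 / (n : ℝ) * (∑ k ∈ Finset.Icc 1 n, F x (T^[k] x)) ^ 2) μ) ∧
    Tendsto (fun n : ℕ => ∫ x, 1 / (n : ℝ) * (∑ k ∈ Finset.Icc 1 n, F x (T^[k] x)) ^ 2 ∂μ)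
      atTop (𝓝 (∫ x, asymptoticVariance T μ (F x) ∂μ)) := by
  obtain ⟨C, δ, hC, hδ0, hδ1, h3⟩ := exists_integral_three_le hα0 hT hdec
  have hL1' : (1 : ℝ) ≤ L := hL1
  have hL0 : (0 : ℝ) ≤ L := L.2
  have hTm : ∀ n, Measurable T^[n] := fun n => (hT.iterate n).measurable
  have hFcont : ∀ x, Continuous fun a => F a x := fun x => (hFa x).continuous hα0
  have hFm : Measurable (Function.uncurry F) :=
    measurable_uncurry_of_continuous_of_measurable hFcont
      fun a => ((hFx a).continuous hα0).measurable
  have hFm' : ∀ a, Measurable (F a) := fun a => ((hFx a).continuous hα0).measurable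
  -- the products whose integrals over the diagonal are the correlations
  let g : ℕ → ℕ → X → X → ℝ := fun j k a x => F a (T^[j] x) * F a (T^[k] x)
  have hgm : ∀ j k, Measurable (Function.uncurry (g j k)) := fun j k =>
    (hFm.comp (measurable_fst.prodMk ((hTm j).comp measurable_snd))).mul
      (hFm.comp (measurable_fst.prodMk ((hTm k).comp measurable_snd)))
  have hgL : ∀ j k a x, |g j k a x| ≤ L ^ 2 := fun j k a x => by
    rw [sq]
    exact abs_mul_le_of_abs_le (hFL _ _) (hFL _ _)
  have hgα : ∀ j k a b x, |g j k a x - g j k b x| ≤ 2 * (L : ℝ) ^ 2 * dist a b ^ (α : ℝ) :=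
    fun j k a b x => abs_mul_sub_mul_le (hFL _ _) (hFL _ _) ((hFa _).abs_sub_le a b)
      ((hFa _).abs_sub_le a b)
  have hgi : ∀ j k, Integrable (fun x => g j k x x) μ := fun j k =>
    Integrable.of_bound
      ((hgm j k).comp (measurable_id.prodMk measurable_id)).aestronglyMeasurable (L ^ 2)
      (ae_of_all _ fun x => hgL j k x x)
  -- autocorrelations of the frozen observables
  let R : ℕ → X → ℝ := fun r a => autocorrelation T μ (F a) r
  have hgi' : ∀ r a, Integrable (g 0 r a) μ := fun r a =>
    Integrable.of_bound ((hgm 0 r).comp measurable_prodMk_left).aestronglyMeasurable (L ^ 2)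
      (ae_of_all _ fun x => hgL 0 r a x)
  have hRcont : ∀ r, Continuous (R r) := fun r =>
    continuous_of_dominated (F := fun a x => g 0 r a x) (bound := fun _ => (L : ℝ) ^ 2)
      (fun a => (hgi' r a).aestronglyMeasurable) (fun a => ae_of_all _ fun x => hgL 0 r a x)
      (integrable_const _) (ae_of_all _ fun x => (hFcont _).mul (hFcont _))
  have hRL : ∀ r a, |R r a| ≤ L ^ 2 := fun r a => by
    have := norm_integral_le_of_norm_le_const (μ := μ) (f := g 0 r a)
      (ae_of_all _ fun x => hgL 0 r a x)
    rw [show R r a = ∫ x, g 0 r a x ∂μ from rfl]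
    simpa using this
  have hRα : ∀ r a b, |R r a - R r b| ≤ 2 * (L : ℝ) ^ 2 * dist a b ^ (α : ℝ) := fun r a b => by
    have h1 : R r a - R r b = ∫ x, (g 0 r a x - g 0 r b x) ∂μ :=
      (integral_sub (hgi' r a) (hgi' r b)).symm
    rw [h1]
    have := norm_integral_le_of_norm_le_const (μ := μ) (f := fun x => g 0 r a x - g 0 r b x)
      (ae_of_all _ fun x => hgα 0 r a b x)
    simpa using this
  have hRi : ∀ r, Integrable (R r) μ := fun r =>
    Integrable.of_bound (hRcont r).aestronglyMeasurable (L ^ 2) (ae_of_all _ (hRL r))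
  -- decay of the autocorrelations: the weight is `1` and the first two times coincide
  have hRδ : ∀ a r, ‖R (r + 1) a‖ ≤ C * (L ^ 3 + 3 * (L * L ^ 2)) * δ ^ (r + 1) := by
    intro a r
    have := (h3 L L (fun _ => 1) (F a) (F a) (fun x => by simpa using hL1') (hFL a) (hFL a)
      (HolderWith.const (y := (1 : ℝ))) (hFx a) (hFx a) 0 (r + 1)).1 r.succ_pos (hF0 a)
    simpa [R, autocorrelation] using this
  have hδsum : Summable fun r : ℕ => C * (L ^ 3 + 3 * (L * L ^ 2)) * δ ^ (r + 1) :=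
    ((summable_nat_add_iff 1).2 (summable_geometric_of_lt_one hδ0.le hδ1)).mul_left _
  have hvar : ∀ a, asymptoticVariance T μ (F a) = R 0 a + 2 * ∑' r, R (r + 1) a := fun a => by
    simp only [asymptoticVariance, R, autocorrelation, Function.iterate_zero, id, sq]
  have htsum_cont : Continuous fun a => ∑' r, R (r + 1) a :=
    continuous_tsum (fun r => hRcont (r + 1)) hδsum fun r a => hRδ a r
  have htsum_int : Integrable (fun a => ∑' r, R (r + 1) a) μ := by
    refine Integrable.of_bound htsum_cont.aestronglyMeasurable
      (∑' r : ℕ, C * (L ^ 3 + 3 * (L * L ^ 2)) * δ ^ (r + 1)) (ae_of_all _ fun a => ?_)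
    exact tsum_of_norm_bounded hδsum.hasSum (hRδ a)
  have hsq : ∀ (n : ℕ) (x : X), 1 / (n : ℝ) * (∑ k ∈ Finset.Icc 1 n, F x (T^[k] x)) ^ 2 =
      1 / (n : ℝ) * ∑ j ∈ Finset.range n, ∑ k ∈ Finset.range n, g (j + 1) (k + 1) x x := by
    intro n x
    rw [sum_Icc_one_eq_sum_range, sq, Finset.sum_mul_sum]
  have hsqi : ∀ n : ℕ, Integrable (fun x =>
      ∑ j ∈ Finset.range n, ∑ k ∈ Finset.range n, g (j + 1) (k + 1) x x) μ := fun n =>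
    integrable_finsetSum _ fun j _ => integrable_finsetSum _ fun k _ => hgi _ _
  refine ⟨fun x => Summable.of_norm_bounded hδsum (hRδ x), ?_, fun n => ?_, ?_⟩
  · simp only [hvar]
    exact (hRi 0).add (htsum_int.const_mul 2)
  · simp only [hsq]
    exact (hsqi n).const_mul _
  -- both estimates on the correlations come from testing on the diagonal
  set M : ℝ := 4 * C * L ^ 3 + 4 * L ^ 2 with hMdef
  have hCL : 0 ≤ C * (L : ℝ) ^ 3 := by positivity
  have hML : 4 * (L : ℝ) ^ 2 ≤ M := by linarith
  have hLsq : 0 ≤ (L : ℝ) ^ 2 := by positivity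
  have hM0 : 0 ≤ M := by linarith
  obtain ⟨B, q, hB0, hq0, hq1, hdiag⟩ := exists_integral_diagonal_le μ hX hα0 hα1 hM0 hδ0 hδ1
  have hweight : ∀ (K : ℝ≥0), 1 ≤ K → ∀ N : ℕ,
      C * (L ^ 3 + 3 * ((L * K : ℝ≥0) * L ^ 2)) * δ ^ N ≤ M * K * δ ^ N := by
    intro K hK N
    have hK' : (1 : ℝ) ≤ K := hK
    have : C * (L ^ 3 + 3 * ((L * K : ℝ≥0) * L ^ 2)) ≤ M * K := by
      push_cast
      nlinarith [mul_nonneg hCL (sub_nonneg.2 hK'), mul_nonneg hLsq K.2]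
    gcongr
  have hLK : ∀ K : ℝ≥0, 1 ≤ K → L ≤ L * K ∧ K ≤ L * K := fun K hK =>
    ⟨le_mul_of_one_le_right L.2 hK, le_mul_of_one_le_left K.2 hL1⟩
  have hρL : ∀ ρ : X → ℝ, (∀ x, 0 ≤ ρ x ∧ ρ x ≤ 1) → ∀ x, |ρ x| ≤ L := fun ρ hρ x => by
    rw [abs_of_nonneg (hρ x).1]
    exact (hρ x).2.trans hL1'
  have hgap : ∀ j r : ℕ, |∫ x, g j (j + (r + 1)) x x ∂μ| ≤ B * q ^ (r + 1) := by
    intro j r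
    refine hdiag (r + 1) (g j (j + (r + 1))) (hgm _ _)
      (fun a x => (hgL _ _ a x).trans (by linarith)) (fun a b x => (hgα _ _ a b x).trans ?_) ?_
    · have : 0 ≤ dist a b ^ (α : ℝ) := by positivity
      gcongr
      linarith
    · intro a K ρ hK hρ hρK
      obtain ⟨hK1, hK2⟩ := hLK K hK
      exact ((h3 L (L * K) ρ (F a) (F a) (hρL ρ hρ) (hFL a) (hFL a) (hρK.mono hK2)
        ((hFx a).mono hK1) ((hFx a).mono hK1) j (r + 1)).1 r.succ_pos (hF0 a)).trans
        (hweight K hK _)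
  have hlim : ∀ j r : ℕ, |∫ x, g (j + 1) (j + 1 + r) x x ∂μ - ∫ x, R r x ∂μ| ≤
      B * q ^ (j + 1) := by
    intro j r
    rw [← integral_sub (hgi _ _) (hRi r)]
    refine hdiag (j + 1) (fun a x => g (j + 1) (j + 1 + r) a x - R r a)
      ((hgm _ _).sub ((hRcont r).measurable.comp measurable_fst)) (fun a x => ?_)
      (fun a b x => ?_) ?_
    · have h1 := hgL (j + 1) (j + 1 + r) a x
      have h2 := hRL r a
      refine (abs_sub _ _).trans ?_
      linarith
    · have h1 := hgα (j + 1) (j + 1 + r) a b x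
      have h2 := hRα r a b
      have h3 : 4 * (L : ℝ) ^ 2 * dist a b ^ (α : ℝ) ≤ M * dist a b ^ (α : ℝ) := by gcongr
      rw [sub_sub_sub_comm]
      refine (abs_sub _ _).trans ?_
      linarith
    · intro a K ρ hK hρ hρK
      obtain ⟨hK1, hK2⟩ := hLK K hK
      exact ((h3 L (L * K) ρ (F a) (F a) (hρL ρ hρ) (hFL a) (hFL a) (hρK.mono hK2)
        ((hFx a).mono hK1) ((hFx a).mono hK1) (j + 1) r).2 j.succ_pos).trans (hweight K hK _)
  have key := tendsto_normalized_sum_square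
    (a := fun j k => ∫ x, g (j + 1) (k + 1) x x ∂μ) (A := fun r => ∫ x, R r x ∂μ)
    (fun j k => integral_congr_ae (ae_of_all _ fun x => mul_comm _ _)) hq0 hq1
    (fun j r => by
      have := hgap (j + 1) r
      rwa [show j + 1 + (r + 1) = j + (r + 1) + 1 by ring] at this)
    (fun r => by
      rw [tendsto_iff_norm_sub_tendsto_zero]
      refine squeeze_zero (fun j => norm_nonneg _) (fun j => ?_)
        (g := fun j => B * q ^ (j + 1)) ?_
      · have := hlim j r
        rwa [show j + 1 + r = j + r + 1 by ring] at this
      · have := ((tendsto_add_atTop_iff_nat 1).2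
          (tendsto_pow_atTop_nhds_zero_of_lt_one hq0 hq1)).const_mul B
        simpa using this)
  have hrhs : ∫ x, asymptoticVariance T μ (F x) ∂μ =
      ∫ x, R 0 x ∂μ + 2 * ∑' r, ∫ x, R (r + 1) x ∂μ := by
    have h1 : Summable fun r => ∫ x, ‖R (r + 1) x‖ ∂μ := by
      refine Summable.of_nonneg_of_le (fun r => integral_nonneg fun x => norm_nonneg _)
        (fun r => ?_) hδsum
      have := integral_mono (hRi (r + 1)).norm (integrable_const _) fun x => hRδ x r
      simpa using this
    simp only [hvar]
    rw [integral_add (hRi 0) (htsum_int.const_mul 2), integral_const_mul,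
      integral_tsum_of_summable_integral_norm (fun r => hRi (r + 1)) h1]
  rw [hrhs]
  refine key.congr fun n => ?_
  simp only [hsq]
  rw [integral_const_mul, integral_finsetSum _ fun j _ => integrable_finsetSum _ fun k _ => hgi _ _]
  congr 1
  exact Finset.sum_congr rfl fun j _ => (integral_finsetSum _ fun k _ => hgi _ _).symm

end Families

/-! ### Hölder regularity of centered compositions -/

section CenteredCompositions

/-- The centered compositions of a Hölder function with a Hölder family of uniformly Hölder maps
form a bounded family that is Hölder in both variables, with one exponent and one constant. -/
theorem exists_holder_centeredComp {X : Type*} [MetricSpace X] [CompactSpace X]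
    [MeasurableSpace X] [BorelSpace X] (μ : Measure X) [IsProbabilityMeasure μ]
    {θ : X → X → X} (hθ : HolderFamily θ) (hreg : HolderDependence θ)
    {φ : X → ℝ} (hφ : ∃ η : ℝ≥0, 0 < η ∧ MemHolder η φ) :
    ∃ α L : ℝ≥0, 0 < α ∧ α ≤ 1 ∧ 1 ≤ L ∧ (∀ a x, |centeredComp μ φ (θ a) x| ≤ L) ∧
      (∀ a, HolderWith L α (centeredComp μ φ (θ a))) ∧
      (∀ x, HolderWith L α fun a => centeredComp μ φ (θ a) x) ∧
      ∀ a, ∫ x, centeredComp μ φ (θ a) x ∂μ = 0 := by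
  obtain ⟨β, hβ, Cφ, hφ⟩ := hφ
  obtain ⟨η, hη, A, hA⟩ := hθ
  obtain ⟨γ, hγ, Cγ, hCγ⟩ := hreg
  obtain ⟨D, hD⟩ := Metric.boundedSpace_iff_edist.1 (inferInstance : BoundedSpace X)
  have hφc := hφ.continuous hβ
  obtain ⟨S, hS⟩ := isCompact_univ.exists_bound_of_continuousOn hφc.continuousOn
  replace hS : ∀ x, |φ x| ≤ S := fun x => hS x trivial
  lift γ to ℝ≥0 using hγ.le
  have hγ' : 0 < γ := hγ
  have hθdep : ∀ z, HolderWith Cγ.toNNReal γ fun a => θ a z := by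
    intro z
    refine holderWith_of_dist_le fun x y => (hCγ x y z).trans ?_
    gcongr
    exact Real.le_coe_toNNReal Cγ
  -- Hölder exponents may be lowered because `X` is bounded, so one exponent serves both variables
  set α : ℝ≥0 := min 1 (min (β * η) (β * γ))
  have hα0 : 0 < α := lt_min one_pos (lt_min (mul_pos hβ hη) (mul_pos hβ hγ'))
  have hα1 : α ≤ 1 := min_le_left _ _
  obtain ⟨K, hKx, hKa⟩ : ∃ K : ℝ≥0, (∀ a, HolderWith K α fun x => φ (θ a x)) ∧
      ∀ x, HolderWith K α fun a => φ (θ a x) := by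
    refine ⟨_, fun a => ((hφ.comp (hA a)).of_le hD ?_).mono (le_max_left _ _),
      fun x => ((hφ.comp (hθdep x)).of_le hD ?_).mono (le_max_right _ _)⟩
    · exact (min_le_right _ _).trans (min_le_left _ _)
    · exact (min_le_right _ _).trans (min_le_right _ _)
  have hint : ∀ a, Integrable (fun x => φ (θ a x)) μ := fun a =>
    Integrable.of_bound ((hKx a).continuous hα0).aestronglyMeasurable S
      (ae_of_all _ fun x => hS _)
  have hmean : ∀ a, |∫ x, φ (θ a x) ∂μ| ≤ S := fun a => by
    have := norm_integral_le_of_norm_le_const (μ := μ) (f := fun x => φ (θ a x))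
      (ae_of_all _ fun x => hS _)
    simpa using this
  have hmeanK : ∀ a b, |∫ x, φ (θ a x) ∂μ - ∫ x, φ (θ b x) ∂μ| ≤ K * dist a b ^ (α : ℝ) := by
    intro a b
    rw [← integral_sub (hint a) (hint b)]
    have := norm_integral_le_of_norm_le_const (μ := μ) (f := fun x => φ (θ a x) - φ (θ b x))
      (ae_of_all _ fun x => (hKa x).abs_sub_le a b)
    simpa using this
  refine ⟨α, 1 + 2 * S.toNNReal + 2 * K, hα0, hα1, ?_, fun a x => ?_, fun a => ?_, fun x => ?_,
    fun a => ?_⟩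
  · rw [add_assoc]
    exact le_self_add
  · have h1 := hS (θ a x)
    have h2 := hmean a
    have h3 := Real.le_coe_toNNReal S
    have h4 : |centeredComp μ φ (θ a) x| ≤ |φ (θ a x)| + |∫ z, φ (θ a z) ∂μ| := abs_sub _ _
    push_cast
    linarith [K.2, K.coe_nonneg]
  · refine holderWith_of_dist_le fun x y => ?_
    rw [Real.dist_eq]
    have h1 := (hKx a).abs_sub_le x y
    have h2 : (K : ℝ) ≤ (1 + 2 * S.toNNReal + 2 * K : ℝ≥0) := by
      push_cast
      linarith [K.coe_nonneg, S.toNNReal.coe_nonneg]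
    simp only [centeredComp, sub_sub_sub_cancel_right]
    exact h1.trans (by gcongr)
  · refine holderWith_of_dist_le fun a b => ?_
    rw [Real.dist_eq]
    have h1 := (hKa x).abs_sub_le a b
    have h2 := hmeanK a b
    have h3 : (2 * K : ℝ) ≤ (1 + 2 * S.toNNReal + 2 * K : ℝ≥0) := by
      push_cast
      linarith [S.toNNReal.coe_nonneg]
    simp only [centeredComp]
    rw [sub_sub_sub_comm]
    refine (abs_sub _ _).trans ?_
    calc _ ≤ 2 * (K : ℝ) * dist a b ^ (α : ℝ) := by linarith
      _ ≤ _ := by gcongr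
  · simp only [centeredComp]
    rw [integral_sub (hint a) (integrable_const _)]
    simp

end CenteredCompositions

theorem mainTheorem7
    {E : Type*} [NormedAddCommGroup E] [NormedSpace ℝ E] [FiniteDimensional ℝ E]
    {H : Type*} [TopologicalSpace H] (I : ModelWithCorners ℝ E H)
    {X : Type*} [MetricSpace X] [CompactSpace X] [ChartedSpace H X] [IsManifold I ∞ X]
    [Bundle.RiemannianBundle (fun x : X => TangentSpace I x)]
    [IsContMDiffRiemannianBundle I ∞ E (fun x : X => TangentSpace I x)]
    [IsRiemannianManifold I X]
    [MeasurableSpace X] [BorelSpace X]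
    (μ : Measure X) [IsProbabilityMeasure μ]
    (T : X → X) (hT : MeasurePreserving T μ μ)
    (hdec : MultipleDecorrelation T μ)
    (θ : X → X → X) (hθ : HolderFamily θ) (hreg : HolderDependence θ)
    (φ : X → ℝ) (hφ : ∃ η : ℝ≥0, 0 < η ∧ MemHolder η φ) (hφ0 : ∫ x, φ x ∂μ = 0) :
    (∀ x, Summable fun k : ℕ => autocorrelation T μ (centeredComp μ φ (θ x)) (k + 1)) ∧
    Integrable (fun x => asymptoticVariance T μ (centeredComp μ φ (θ x))) μ ∧
    (∀ n : ℕ, Integrable (fun x =>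
      1 / (n : ℝ) * (∑ k ∈ Finset.Icc 1 n, centeredComp μ φ (θ x) (T^[k] x)) ^ 2) μ) ∧
    Filter.Tendsto
      (fun n : ℕ => ∫ x,
        1 / (n : ℝ) * (∑ k ∈ Finset.Icc 1 n, centeredComp μ φ (θ x) (T^[k] x)) ^ 2 ∂μ)
      Filter.atTop
      (𝓝 (∫ x, asymptoticVariance T μ (centeredComp μ φ (θ x)) ∂μ)) := by
  have hcov : HasPolynomialCovers (Set.univ : Set X) := by
    have : IsManifold I 1 X := IsManifold.of_le (n := ∞) (by simp)
    have : IsContinuousRiemannianBundle E (fun x : X => TangentSpace I x) := by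
      -- a smooth Riemannian metric is continuous
      obtain ⟨g, hg, hg'⟩ := IsContMDiffRiemannianBundle.exists_contMDiff (IB := I) (n := ∞) (F := E)
        (E := fun x : X => TangentSpace I x)
      exact ⟨g, hg.continuous, hg'⟩
    exact hasPolynomialCovers_univ_of_isRiemannianManifold I
  obtain ⟨α, L, hα0, hα1, hL1, hFL, hFx, hFa, hF0⟩ := exists_holder_centeredComp μ hθ hreg hφ
  exact tendsto_variance_of_holder_family hcov hT hα0 hα1 (hdec α hα0 hα1) hL1 hFL hFx hFa hF0
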